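/- Let $G$ be a finite simple graph with $n \ge 9$ vertices and $e$ edges, minimum degree $\delta$ and maximum degree $\Delta$, and let $M_1(G) = \sum_{u \in V(G)} d_G(u)^2$ be its first Zagreb index, where $d_G(u)$ is the degree of $u$. Let $k \ge 1$ and suppose that $G$ is $k$-connected, i.e. $n > k$ and deleting any set of fewer than $k$ vertices leaves a connected graph. If $$M_1(G) \ge (n-k-2)\,\Delta^2 + \frac{\bigl(e(\delta+n-k-2)\bigr)^2}{4\,\delta\,(n-k-2)(k+2)}$$ (where, in the degenerate case $k = n-2$, the fraction is read as $0$), then $G$ is traceable, i.e. $G$ has a path containing all its vertices, or $G$ is isomorphic to the complete bipartite graph $K_{k,\,k+2}$. -/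

import Mathlib

namespace ZagrebTraceable

/-- `G` is `k`-connected: it has more than `k` vertices, and deleting any set of fewer than
`k` vertices leaves a connected graph. (So the complete graph on `n` vertices is
`k`-connected exactly for `k ≤ n - 1`.) -/
def IsKConnected {V : Type*} [Fintype V] (G : SimpleGraph V) (k : ℕ) : Prop :=
  k < Fintype.card V ∧
    ∀ S : Finset V, S.card < k → (G.induce {v : V | v ∉ S}).Connected

/-- The first Zagreb index of `G`: the sum of the squares of the vertex degrees. -/
def firstZagreb {V : Type*} [Fintype V] (G : SimpleGraph V) [DecidableRel G.Adj] : ℕ :=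
  ∑ v : V, G.degree v ^ 2

/-- `G` is traceable: it has a Hamiltonian path (a walk visiting every vertex exactly once). -/
def IsTraceable {V : Type*} [DecidableEq V] (G : SimpleGraph V) : Prop :=
  ∃ (u v : V) (p : G.Walk u v), p.IsHamiltonian

end ZagrebTraceable

/-! If `G` is not traceable, the Chvátal–Erdős argument (`exists_isIndepSet_of_not_isTraceable`)
gives an independent set `I` of `k + 2` vertices. Put `N = |Iᶜ| = n - k - 2`. Degrees on `I` lie in
`[δ, N]`, so `(d - δ)(N - d) ≥ 0`. As degrees over `I` sum to at most `e`, summing gives `∑_I d² ≤ X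
- Y` with `X = e(δ + N)` and `Y = (k + 2)δN`, and `X - Y ≤ X²/(4Y)`. Bounding degrees on `Iᶜ` by `Δ`
shows that `M₁` is at most the assumed lower bound, so every step is an equality
(`firstZagreb_extremal`).

Hence `G` is bipartite with sides `I` and `Iᶜ`, degrees on `I` are `δ` or `N`, and those on `Iᶜ` are
`Δ`. The case `δ < N` is impossible by `bipartite_arithmetic`. If `δ = N`, then `G` is complete
bipartite with `k ≤ N ≤ k + 2`: `N = k` is the exceptional graph, and the other two values give
traceable graphs. -/

namespace ZagrebTraceable

variable {V : Type*} {G : SimpleGraph V}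

/-! ### Paths as lists, and the exchanges that lengthen them. -/

/-- A list of vertices that traces a path of `G`. -/
def IsPathList (G : SimpleGraph V) (l : List V) : Prop := l.IsChain G.Adj ∧ l.Nodup

/-- `m` traces a path of `G` from `x` to `y` that avoids the list `l`. -/
def IsDetour (G : SimpleGraph V) (l : List V) (x y : V) (m : List V) : Prop :=
  IsPathList G m ∧ m.Disjoint l ∧ m.head? = some x ∧ m.getLast? = some y

lemma exists_isDetour_of_reachable [DecidableEq V] {l : List V} {x y : {v | v ∉ l}}
    (h : (G.induce {v | v ∉ l}).Reachable x y) : ∃ m, IsDetour G l x y m := by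
  obtain ⟨w⟩ := h
  refine ⟨w.toPath.1.support.map Subtype.val, ⟨?_, ?_⟩, ?_, ?_, ?_⟩
  · rw [List.isChain_map]
    exact w.toPath.1.isChain_adj_support
  · exact w.toPath.2.support_nodup.map Subtype.val_injective
  · intro a ha hal
    obtain ⟨b, -, rfl⟩ := List.mem_map.1 ha
    exact b.2 hal
  · rw [List.head?_map, List.head?_eq_some_head (SimpleGraph.Walk.support_ne_nil _)]
    simp
  · rw [List.getLast?_map, List.getLast?_eq_some_getLast (SimpleGraph.Walk.support_ne_nil _)]
    simp

lemma exists_longest_isPathList [Fintype V] (G : SimpleGraph V) :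
    ∃ l, IsPathList G l ∧ ∀ l', IsPathList G l' → l'.length ≤ l.length := by
  classical
  let P : ℕ → Prop := fun n => ∃ l, IsPathList G l ∧ l.length = n
  have h0 : P 0 := ⟨[], ⟨by simp, by simp⟩, rfl⟩
  obtain ⟨l, hl, hlen⟩ := Nat.findGreatest_spec (P := P) (Nat.zero_le (Fintype.card V)) h0
  refine ⟨l, hl, fun l' hl' => ?_⟩
  rw [hlen]
  exact Nat.le_findGreatest hl'.2.length_le_card ⟨l', hl', rfl⟩

lemma isTraceable_of_isPathList [DecidableEq V] {l : List V} (hne : l ≠ [])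
    (hl : IsPathList G l) (hall : ∀ v, v ∈ l) : IsTraceable G := by
  refine ⟨_, _, SimpleGraph.Walk.ofSupport l hne hl.1, fun a => ?_⟩
  rw [SimpleGraph.Walk.support_ofSupport]
  exact List.count_eq_one_of_mem hl.2 (hall a)

lemma IsDetour.isPathList_insert {l₁ l₂ m : List V} {x y a b : V}
    (hl : IsPathList G (l₁ ++ l₂)) (hm : IsDetour G (l₁ ++ l₂) x y m)
    (ha : l₁.getLast? = some a) (hb : l₂.head? = some b) (hax : G.Adj a x) (hyb : G.Adj y b) :
    IsPathList G (l₁ ++ m ++ l₂) := by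
  obtain ⟨⟨hmc, hmn⟩, hd, hx, hy⟩ := hm
  obtain ⟨hc, hn⟩ := hl
  have hm0 : m ≠ [] := by rintro rfl; simp at hx
  constructor
  · rw [List.isChain_append] at hc
    rw [List.isChain_append, List.isChain_append]
    refine ⟨⟨hc.1, hmc, ?_⟩, hc.2.1, ?_⟩
    · simp [ha, hx, hax]
    · rw [List.getLast?_append_of_ne_nil _ hm0]
      simp [hy, hb, hyb]
  · rw [List.append_assoc, (List.perm_append_comm_assoc l₁ m l₂).nodup_iff, List.nodup_append']
    exact ⟨hmn, hn, hd⟩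

/-- Crossing exchange: leave `l₁` through the detour, run `l₂` backwards from `c` to `b`, and jump
along `b d` into `l₃`. -/
lemma IsDetour.isPathList_insert_reverse {l₁ l₂ l₃ m : List V} {x y a b c d : V}
    (hl : IsPathList G (l₁ ++ l₂ ++ l₃)) (hm : IsDetour G (l₁ ++ l₂ ++ l₃) x y m)
    (ha : l₁.getLast? = some a) (hb : l₂.head? = some b) (hc : l₂.getLast? = some c)
    (hd : l₃.head? = some d) (hax : G.Adj a x) (hyc : G.Adj y c) (hbd : G.Adj b d) :
    IsPathList G (l₁ ++ m ++ l₂.reverse ++ l₃) := by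
  obtain ⟨⟨hmc, hmn⟩, hdis, hx, hy⟩ := hm
  obtain ⟨hch, hn⟩ := hl
  have hm0 : m ≠ [] := by rintro rfl; simp at hx
  have hl0 : l₂.reverse ≠ [] := by rintro h; simp_all
  constructor
  · rw [List.isChain_append, List.isChain_append] at hch
    obtain ⟨⟨h1, h2, -⟩, h3, -⟩ := hch
    rw [List.isChain_append, List.isChain_append, List.isChain_append]
    refine ⟨⟨⟨h1, hmc, by simp [ha, hx, hax]⟩, ?_, ?_⟩, h3, ?_⟩
    · rw [List.isChain_reverse]
      exact h2.imp fun _ _ h => h.symm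
    · rw [List.getLast?_append_of_ne_nil _ hm0, List.head?_reverse]
      simp [hy, hc, hyc]
    · rw [List.getLast?_append_of_ne_nil _ hl0, List.getLast?_reverse]
      simp [hb, hd, hbd]
  · have hp : (l₁ ++ m ++ l₂.reverse ++ l₃).Perm (m ++ (l₁ ++ l₂ ++ l₃)) := by
      rw [List.append_assoc, List.append_assoc]
      refine (List.perm_append_comm_assoc _ _ _).trans (List.Perm.append_left _ ?_)
      rw [List.append_assoc]
      exact List.Perm.append_left _ ((List.reverse_perm _).append_right _)
    rw [hp.nodup_iff, List.nodup_append']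
    exact ⟨hmn, hn, hdis⟩

lemma IsPathList.cons_reverse {l₁ l₂ : List V} {x a b c : V}
    (hl : IsPathList G (l₁ ++ l₂)) (hx : x ∉ l₁ ++ l₂) (ha : l₁.getLast? = some a)
    (hc : l₁.head? = some c) (hb : l₂.head? = some b) (hax : G.Adj a x) (hcb : G.Adj c b) :
    IsPathList G (x :: (l₁.reverse ++ l₂)) := by
  obtain ⟨hch, hn⟩ := hl
  have hl0 : l₁.reverse ≠ [] := by rintro h; simp_all
  constructor
  · rw [List.isChain_append] at hch
    obtain ⟨h1, h2, -⟩ := hch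
    rw [List.isChain_cons, List.isChain_append, List.head?_append_of_ne_nil _ hl0, List.head?_reverse,
      List.getLast?_reverse, List.isChain_reverse]
    exact ⟨by simp [ha, hax.symm], h1.imp fun _ _ h => h.symm, h2, by simp [hc, hb, hcb]⟩
  · have hp : (l₁.reverse ++ l₂).Perm (l₁ ++ l₂) := (List.reverse_perm _).append_right _
    rw [List.nodup_cons, hp.nodup_iff, hp.mem_iff]
    exact ⟨hx, hn⟩

/-- The Chvátal–Erdős theorem for paths. -/
theorem exists_isIndepSet_of_not_isTraceable [Fintype V] [DecidableEq V] {k : ℕ} (hk : 1 ≤ k)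
    (hG : IsKConnected G k) (hT : ¬ IsTraceable G) :
    ∃ s : Finset V, G.IsIndepSet (s : Set V) ∧ s.card = k + 2 := by
  classical
  obtain ⟨l, hl, hmax⟩ := exists_longest_isPathList G
  have hV : Nonempty V := Fintype.card_pos_iff.1 (by have := hG.1; omega)
  have hl0 : l ≠ [] := by
    rintro rfl
    have := hmax [hV.some] ⟨by simp, by simp⟩
    simp at this
  have hpos : 0 < l.length := List.length_pos_iff.2 hl0
  obtain ⟨x, hx⟩ : ∃ x, x ∉ l := by
    by_contra! h
    exact hT (isTraceable_of_isPathList hl0 hl h)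
  set v₀ := l[0] with hv₀
  -- The component of `x` off the longest path.
  let H : Set V := {y | ∃ hy : y ∉ l, (G.induce {v | v ∉ l}).Reachable ⟨x, hx⟩ ⟨y, hy⟩}
  have hxH : x ∈ H := ⟨hx, .refl _⟩
  have hHl : ∀ y ∈ H, y ∉ l := fun y hy => hy.1
  have hHadj : ∀ y ∈ H, ∀ z, G.Adj y z → z ∈ l ∨ z ∈ H := by
    rintro y ⟨hy, hr⟩ z hyz
    by_cases hz : z ∈ l
    · exact .inl hz
    · exact .inr ⟨hz, hr.trans (SimpleGraph.Adj.reachable (by simpa using hyz))⟩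
  have hdet : ∀ y ∈ H, ∀ z ∈ H, ∃ m, IsDetour G l y z m := by
    rintro y ⟨hy, hry⟩ z ⟨hz, hrz⟩
    exact exists_isDetour_of_reachable (hry.symm.trans hrz)
  have hmlen : ∀ {y z m}, IsDetour G l y z m → 0 < m.length := by
    rintro y z m ⟨-, -, h, -⟩
    cases m <;> simp_all
  have hfirst : ∀ y ∈ H, ¬ G.Adj v₀ y := by
    intro y hy ha
    have : IsPathList G (y :: l) := by
      refine ⟨?_, List.nodup_cons.2 ⟨hHl y hy, hl.2⟩⟩
      rw [List.isChain_cons, List.head?_eq_getElem?, List.getElem?_eq_getElem hpos]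
      exact ⟨by simpa using ha.symm, hl.1⟩
    simpa using hmax _ this
  -- the positions on the path that are adjacent to `H`
  let A : Finset ℕ := (Finset.range l.length).filter fun i => ∃ y ∈ H, ∃ a, l[i]? = some a ∧ G.Adj a y
  have hA : ∀ i ∈ A, ∃ hi : i + 1 < l.length, ∃ y ∈ H, G.Adj l[i] y := by
    intro i hi
    obtain ⟨hi, y, hy, a, hia, hay⟩ := by simpa [A] using hi
    rw [List.getElem?_eq_getElem hi, Option.some_inj] at hia
    subst hia
    refine ⟨?_, y, hy, hay⟩
    -- The last vertex has no neighbour in `H`, or the path could be extended; so every position in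
    -- `A` has a successor.
    by_contra hlt
    have hi' : i = l.length - 1 := by omega
    have : IsPathList G (l ++ [y]) := by
      refine ⟨?_, ?_⟩
      · rw [List.isChain_append, List.getLast?_eq_getElem?, ← hi', List.getElem?_eq_getElem hi]
        exact ⟨hl.1, by simp, by simpa using hay⟩
      · rw [List.nodup_append']
        refine ⟨hl.2, by simp, ?_⟩
        simpa using hHl y hy
    simpa using hmax _ this
  have hcardA : k ≤ A.card := by
    -- Otherwise deleting the fewer than `k` path vertices adjacent to `H` would separate `x` from
    -- `v₀`.
    by_contra! hlt
    let S : Finset V := A.image fun i => l.getD i v₀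
    have hS : S.card < k := Finset.card_image_le.trans_lt hlt
    have hSl : ∀ y ∈ H, ∀ z, G.Adj y z → z ∉ S → z ∈ H := by
      intro y hy z hyz hzS
      refine (hHadj y hy z hyz).resolve_left fun hzl => hzS ?_
      obtain ⟨i, hi, rfl⟩ := List.getElem_of_mem hzl
      refine Finset.mem_image.2 ⟨i, ?_, by simp [hi]⟩
      simp only [A, Finset.mem_filter, Finset.mem_range]
      exact ⟨hi, y, hy, l[i], by simp, hyz.symm⟩
    have hSmem : ∀ z ∈ S, ∃ i, ∃ hi : i < l.length, z = l[i] ∧ ∃ y ∈ H, G.Adj l[i] y := by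
      intro z hz
      obtain ⟨i, hi, rfl⟩ := Finset.mem_image.1 hz
      obtain ⟨hi', y, hy, hay⟩ := hA i hi
      exact ⟨i, by omega, by simp [show i < l.length by omega], y, hy, hay⟩
    have hxS : x ∉ S := fun h => by
      obtain ⟨i, hi, rfl, -⟩ := hSmem x h
      exact hx (List.getElem_mem hi)
    have hvS : v₀ ∉ S := fun h => by
      obtain ⟨i, hi, he, y, hy, hay⟩ := hSmem v₀ h
      rw [← he] at hay
      exact hfirst y hy hay
    have hr := (hG.2 S hS).preconnected ⟨x, hxS⟩ ⟨v₀, hvS⟩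
    have key : ∀ z : {v | v ∉ S}, (G.induce {v | v ∉ S}).Reachable ⟨x, hxS⟩ z → (z : V) ∈ H := by
      intro z hz
      rw [SimpleGraph.reachable_iff_reflTransGen] at hz
      induction hz with
      | refl => exact hxH
      | @tail b c _ hbc ih => exact hSl _ ih _ (by simpa using hbc) c.2
    exact hHl _ (key _ hr) (List.getElem_mem hpos)
  -- consecutive splitting of the path
  have hsplit : ∀ i, l.take (i + 1) ++ l.drop (i + 1) = l := fun i => List.take_append_drop _ _
  have hlastTake : ∀ i (hi : i < l.length), (l.take (i + 1)).getLast? = some l[i] := by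
    intro i hi
    rw [List.getLast?_eq_getElem?]
    simp [hi]
  have hheadDrop : ∀ i (hi : i < l.length), (l.drop i).head? = some l[i] := by
    intro i hi
    simp [List.head?_drop, hi]
  have hsuccH : ∀ i ∈ A, ∀ y ∈ H, ∀ b, l[i + 1]? = some b → ¬ G.Adj y b := by
    intro i hi y hy b hb hyb
    obtain ⟨hi', z, hz, haz⟩ := hA i hi
    obtain ⟨m, hm⟩ := hdet z hz y hy
    have h := IsDetour.isPathList_insert (l₁ := l.take (i + 1)) (l₂ := l.drop (i + 1))
      (by rwa [hsplit]) (by rwa [hsplit]) (hlastTake i (by omega))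
      (by rw [List.head?_drop]; exact hb) haz hyb
    have h1 := hmax _ h
    have h2 := hmlen hm
    simp at h1
    omega
  have hsucc0 : ∀ i ∈ A, ∀ b, l[i + 1]? = some b → ¬ G.Adj v₀ b := by
    intro i hi b hb hvb
    obtain ⟨hi', z, hz, haz⟩ := hA i hi
    have h := IsPathList.cons_reverse (l₁ := l.take (i + 1)) (l₂ := l.drop (i + 1))
      (by rwa [hsplit]) (by rw [hsplit]; exact hHl z hz) (hlastTake i (by omega))
      (c := v₀) (by rw [List.head?_take]; simp [hv₀, List.head?_eq_getElem?, hpos])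
      (by rw [List.head?_drop]; exact hb) haz hvb
    have h1 := hmax _ h
    simp at h1
    omega
  have hsucc : ∀ i ∈ A, ∀ j ∈ A, i < j → ∀ b c, l[i + 1]? = some b → l[j + 1]? = some c →
      ¬ G.Adj b c := by
    intro i hi j hj hij b c hb hc hbc
    obtain ⟨hi', y, hy, hay⟩ := hA i hi
    obtain ⟨hj', z, hz, haz⟩ := hA j hj
    obtain ⟨m, hm⟩ := hdet y hy z hz
    have hs : l.take (i + 1) ++ (l.take (j + 1)).drop (i + 1) ++ l.drop (j + 1) = l := by
      have : l.take (i + 1) = (l.take (j + 1)).take (i + 1) := by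
        rw [List.take_take, Nat.min_eq_left (by omega)]
      rw [this, List.take_append_drop, List.take_append_drop]
    have h := IsDetour.isPathList_insert_reverse (l₁ := l.take (i + 1))
      (l₂ := (l.take (j + 1)).drop (i + 1)) (l₃ := l.drop (j + 1))
      (by rwa [hs]) (by rwa [hs]) (hlastTake i (by omega))
      (b := b) (by rw [List.head?_drop, List.getElem?_take, if_pos (by omega)]; exact hb)
      (c := l[j]) (by
        rw [List.getLast?_drop, if_neg (by simp; omega)]
        exact hlastTake j (by omega))
      (by rw [List.head?_drop]; exact hc) hay haz.symm hbc
    have h1 := hmax _ h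
    have h2 := hmlen hm
    simp at h1
    omega
  -- the independent set
  let B : Finset ℕ := insert 0 (A.image (· + 1))
  have hBcard : B.card = A.card + 1 := by
    rw [Finset.card_insert_of_notMem (by simp), Finset.card_image_of_injective _ (add_left_injective 1)]
  have hBlt : ∀ j ∈ B, j < l.length := by
    intro j hj
    rcases Finset.mem_insert.1 hj with rfl | hj
    · exact hpos
    · obtain ⟨i, hi, rfl⟩ := Finset.mem_image.1 hj
      exact (hA i hi).1
  have hBadj : ∀ i ∈ B, ∀ j ∈ B, i < j → ∀ b c, l[i]? = some b → l[j]? = some c → ¬ G.Adj b c := by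
    intro i hi j hj hij b c hb hc
    rcases Finset.mem_insert.1 hj with rfl | hj
    · omega
    obtain ⟨j, hjA, rfl⟩ := Finset.mem_image.1 hj
    rcases Finset.mem_insert.1 hi with rfl | hi
    · have : b = v₀ := by simpa [hpos, hv₀, eq_comm] using hb
      subst this
      exact hsucc0 j hjA c hc
    obtain ⟨i, hiA, rfl⟩ := Finset.mem_image.1 hi
    exact hsucc i hiA j hjA (by omega) b c hb hc
  have hBx : ∀ j ∈ B, ∀ c, l[j]? = some c → ¬ G.Adj x c := by
    intro j hj c hc
    rcases Finset.mem_insert.1 hj with rfl | hj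
    · have : c = v₀ := by simpa [hpos, hv₀, eq_comm] using hc
      subst this
      exact fun h => hfirst x hxH h.symm
    obtain ⟨i, hiA, rfl⟩ := Finset.mem_image.1 hj
    exact hsuccH i hiA x hxH c hc
  -- The start of the path, the successors of the positions in `A`, and `x`. All indices are in
  -- range, so the default `v₀` is never taken.
  let T : Finset V := insert x (B.image fun i => l.getD i v₀)
  have hTcard : T.card = A.card + 2 := by
    rw [Finset.card_insert_of_notMem, Finset.card_image_of_injOn, hBcard]
    · intro i hi j hj hij
      have h1 := hBlt i hi
      have h2 := hBlt j hj
      simp only [List.getD_eq_getElem _ _ h1, List.getD_eq_getElem _ _ h2] at hij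
      exact (List.Nodup.getElem_inj_iff hl.2).1 hij
    · intro h
      obtain ⟨i, hi, rfl⟩ := Finset.mem_image.1 h
      apply hx
      rw [List.getD_eq_getElem _ _ (hBlt i hi)]
      exact List.getElem_mem _
  have hB : ∀ v ∈ B.image fun i => l.getD i v₀, ∃ i ∈ B, l[i]? = some v := by
    intro v hv
    obtain ⟨i, hi, rfl⟩ := Finset.mem_image.1 hv
    exact ⟨i, hi, by rw [List.getD_eq_getElem _ _ (hBlt i hi), List.getElem?_eq_getElem]⟩
  have hTind : G.IsIndepSet (T : Set V) := by
    intro v hv w hw hvw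
    rcases Finset.mem_insert.1 (Finset.mem_coe.1 hv) with rfl | hv
    · rcases Finset.mem_insert.1 (Finset.mem_coe.1 hw) with rfl | hw
      · exact absurd rfl hvw
      · obtain ⟨j, hj, hjw⟩ := hB w hw
        exact hBx j hj w hjw
    · obtain ⟨i, hi, hiv⟩ := hB v hv
      rcases Finset.mem_insert.1 (Finset.mem_coe.1 hw) with rfl | hw
      · exact fun h => hBx i hi v hiv h.symm
      · obtain ⟨j, hj, hjw⟩ := hB w hw
        rcases lt_trichotomy i j with h | rfl | h
        · exact hBadj i hi j hj h v w hiv hjw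
        · exact absurd (Option.some_inj.1 (hiv.symm.trans hjw)) hvw
        · exact fun h' => hBadj j hj i hi h w v hjw hiv h'.symm
  obtain ⟨s, hs, hcard⟩ := Finset.exists_subset_card_eq (show k + 2 ≤ T.card by omega)
  exact ⟨s, hTind.mono (by exact_mod_cast hs), hcard⟩

/-! ### Complete bipartite graphs. -/

variable [Fintype V] [DecidableEq V]

lemma isKConnected_of_complete_bipartite {I : Finset V} {m : ℕ} (hm : 1 ≤ m)
    (hadj : ∀ u ∈ I, ∀ v ∉ I, G.Adj u v) (hI : m ≤ I.card) (hJ : m ≤ Iᶜ.card) :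
    IsKConnected G m := by
  have hc := Finset.card_add_card_compl I
  refine ⟨by omega, fun S hS => ?_⟩
  obtain ⟨i, hi, hiS⟩ := Finset.exists_mem_notMem_of_card_lt_card (hS.trans_le hI)
  obtain ⟨j, hj, hjS⟩ := Finset.exists_mem_notMem_of_card_lt_card (hS.trans_le hJ)
  rw [Finset.mem_compl] at hj
  have hij : (G.induce {v | v ∉ S}).Reachable ⟨i, hiS⟩ ⟨j, hjS⟩ :=
    SimpleGraph.Adj.reachable (by simpa using hadj i hi j hj)
  have key : ∀ w : {v | v ∉ S}, (G.induce {v | v ∉ S}).Reachable w ⟨j, hjS⟩ := by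
    intro w
    by_cases hw : (w : V) ∈ I
    · exact SimpleGraph.Adj.reachable (by simpa using hadj w hw j hj)
    · exact SimpleGraph.Reachable.trans
        (SimpleGraph.Adj.reachable (by simpa using (hadj i hi w hw).symm)) hij
  have : Nonempty {v | v ∉ S} := ⟨⟨i, hiS⟩⟩
  exact ⟨fun a b => (key a).trans (key b).symm⟩

/-- A complete bipartite graph whose sides have `k + 2` and `k + 1` or `k + 2` vertices is
traceable. -/
lemma isTraceable_of_complete_bipartite {I : Finset V} {k : ℕ}
    (hadj : ∀ u ∈ I, ∀ v ∉ I, G.Adj u v) (hI : I.card = k + 2) (hJ : k + 1 ≤ Iᶜ.card)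
    (hJ' : Iᶜ.card ≤ k + 2) : IsTraceable G := by
  -- Such a graph is `(k + 1)`-connected, so non-traceability would give `k + 3` independent
  -- vertices. These fit in neither side, hence meet both.
  by_contra hT
  obtain ⟨s, hs, hcard⟩ := exists_isIndepSet_of_not_isTraceable (by omega)
    (isKConnected_of_complete_bipartite (m := k + 1) (by omega) hadj (by omega) hJ) hT
  obtain ⟨v, hv, hvI⟩ := Finset.exists_mem_notMem_of_card_lt_card (show I.card < s.card by omega)
  obtain ⟨u, hu, huI⟩ := Finset.exists_mem_notMem_of_card_lt_card (show Iᶜ.card < s.card by omega)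
  have huv := hadj u (by simpa using huI) v hvI
  exact hs hu hv huv.ne huv

lemma nonempty_iso_completeBipartiteGraph {I : Finset V} {k : ℕ}
    (hadj : ∀ u ∈ I, ∀ v ∉ I, G.Adj u v) (hI : G.IsIndepSet (I : Set V))
    (hJ : G.IsIndepSet ((Iᶜ : Finset V) : Set V)) (hIc : I.card = k + 2) (hJc : Iᶜ.card = k) :
    Nonempty (G ≃g completeBipartiteGraph (Fin k) (Fin (k + 2))) := by
  have e₁ : {v // v ∈ I} ≃ Fin (k + 2) := Fintype.equivFinOfCardEq (by simpa using hIc)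
  have e₂ : {v // v ∉ I} ≃ Fin k := Fintype.equivFinOfCardEq (by
    rw [← hJc, ← Fintype.card_coe]
    exact Fintype.card_congr (Equiv.subtypeEquivRight (by simp)))
  let e : Fin k ⊕ Fin (k + 2) ≃ V :=
    (Equiv.sumCongr e₂.symm e₁.symm).trans ((Equiv.sumComm _ _).trans (Equiv.sumCompl (· ∈ I)))
  have hl : ∀ x, e (Sum.inl x) ∉ I := fun x => (e₂.symm x).2
  have hr : ∀ x, e (Sum.inr x) ∈ I := fun x => (e₁.symm x).2
  have hI' : ∀ u ∈ I, ∀ v ∈ I, ¬ G.Adj u v := fun u hu v hv h => hI hu hv h.ne h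
  have hJ' : ∀ u ∉ I, ∀ v ∉ I, ¬ G.Adj u v := fun u hu v hv h =>
    hJ (by simpa using hu) (by simpa using hv) h.ne h
  refine ⟨(SimpleGraph.Iso.symm ⟨e, ?_⟩)⟩
  rintro (x | x) (y | y)
  · simpa [completeBipartiteGraph] using hJ' _ (hl x) _ (hl y)
  · simpa [completeBipartiteGraph] using (hadj _ (hr y) _ (hl x)).symm
  · simpa [completeBipartiteGraph] using hadj _ (hr x) _ (hl y)
  · simpa [completeBipartiteGraph] using hI' _ (hr x) _ (hr y)

/-! ### Degree bounds and the equality analysis. -/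

variable [DecidableRel G.Adj]

/-- A neighbourhood with fewer than `k` vertices would be a cut isolating `v`. -/
lemma IsKConnected.le_degree {k : ℕ} (hG : IsKConnected G k) (v : V) : k ≤ G.degree v := by
  by_contra! hlt
  have hv : v ∉ G.neighborFinset v := by simp
  obtain ⟨w, hw⟩ : ∃ w, w ∉ insert v (G.neighborFinset v) := by
    by_contra! h
    have h1 := Finset.card_insert_le v (G.neighborFinset v)
    rw [Finset.eq_univ_iff_forall.2 h, Finset.card_univ, G.card_neighborFinset_eq_degree] at h1
    have := hG.1
    omega
  rw [Finset.mem_insert, not_or] at hw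
  have hc := hG.2 (G.neighborFinset v) (by simpa using hlt)
  have hr := hc.preconnected ⟨v, hv⟩ ⟨w, hw.2⟩
  rw [SimpleGraph.reachable_iff_reflTransGen] at hr
  rcases hr.cases_head with h | ⟨z, hz, -⟩
  · exact hw.1 (congrArg Subtype.val h).symm
  · exact z.2 (by simpa using hz)

lemma neighborFinset_subset_compl {I : Finset V} (hI : G.IsIndepSet (I : Set V)) {u : V}
    (hu : u ∈ I) : G.neighborFinset u ⊆ Iᶜ := by
  intro w hw
  rw [SimpleGraph.mem_neighborFinset] at hw
  exact Finset.mem_compl.2 fun hwI => hI hu hwI hw.ne hw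

/-- The degrees over an independent set sum to at most the number of edges, with equality only
if the complement is independent as well. -/
lemma sum_degree_le_card_edgeFinset {I : Finset V} (hI : G.IsIndepSet (I : Set V)) :
    ∑ u ∈ I, G.degree u ≤ G.edgeFinset.card ∧
      (∑ u ∈ I, G.degree u = G.edgeFinset.card → G.IsIndepSet ((Iᶜ : Finset V) : Set V)) := by
  have h1 : ∑ u ∈ I, G.degree u = ∑ v ∈ Iᶜ, (G.neighborFinset v ∩ I).card := by
    have h := Finset.sum_card_bipartiteAbove_eq_sum_card_bipartiteBelow (s := I) (t := Iᶜ) G.Adj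
    refine (Finset.sum_congr rfl fun u hu => ?_).trans
      (h.trans (Finset.sum_congr rfl fun v _ => ?_))
    · rw [← G.card_neighborFinset_eq_degree]
      congr 1
      ext w
      simp only [Finset.mem_bipartiteAbove, SimpleGraph.mem_neighborFinset]
      refine ⟨fun hw => ⟨?_, hw⟩, And.right⟩
      exact neighborFinset_subset_compl hI hu (by simpa using hw)
    · congr 1
      ext w
      simp [Finset.mem_bipartiteBelow, G.adj_comm, and_comm]
  -- The last sum is the slack: it counts each edge inside `Iᶜ` twice.
  have h2 : ∑ v ∈ Iᶜ, G.degree v = ∑ v ∈ Iᶜ, (G.neighborFinset v ∩ I).card +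
      ∑ v ∈ Iᶜ, (G.neighborFinset v \ I).card := by
    rw [← Finset.sum_add_distrib]
    refine Finset.sum_congr rfl fun v _ => ?_
    rw [Finset.card_inter_add_card_sdiff, G.card_neighborFinset_eq_degree]
  have h3 := Finset.sum_add_sum_compl I fun v => G.degree v
  rw [G.sum_degrees_eq_twice_card_edges] at h3
  refine ⟨by omega, fun he => ?_⟩
  have h4 : ∑ v ∈ Iᶜ, (G.neighborFinset v \ I).card = 0 := by omega
  rw [Finset.sum_eq_zero_iff] at h4
  intro v hv w hw _ hvw
  have h5 := Finset.card_eq_zero.1 (h4 v hv)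
  have h6 : w ∈ G.neighborFinset v \ I :=
    Finset.mem_sdiff.2 ⟨by simpa using hvw, Finset.mem_compl.1 hw⟩
  simp [h5] at h6

/-- Excludes `d = δ < N`: here `a` and `b` count the vertices of `I` of degree `δ` and `N`, and `D =
Δ`. -/
lemma bipartite_arithmetic {k a b d D N : ℕ} (hk : 1 ≤ k) (hn : 9 ≤ N + k + 2) (hab : a + b = k + 2) (hd : k ≤ d)
    (hdN : d < N) (hND : b ≠ 0 → N ≤ D) (hD : D ≤ k + 2) (he : N * D = a * d + b * N)
    (heq : (a * d + b * N) * (d + N) = 2 * (k + 2) * d * N) : False := by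
  have hba : b * N = a * d := by
    -- With `k + 2 = a + b`, the relation `heq` factors in this way.
    have h1 : ((N : ℤ) - d) * (b * N - a * d) = 0 := by
      have h2 : ((a * d + b * N) * (d + N) : ℤ) = 2 * (k + 2) * d * N := by exact_mod_cast heq
      have h3 : (a + b : ℤ) = k + 2 := by exact_mod_cast hab
      rw [← h3] at h2
      linear_combination h2
    rcases mul_eq_zero.1 h1 with h | h
    · omega
    · have : (b * N : ℤ) = a * d := by linarith
      exact_mod_cast this
  have hD2 : D = 2 * b := by
    have : N * D = N * (2 * b) := by rw [he, ← hba]; ring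
    exact Nat.eq_of_mul_eq_mul_left (by omega) this
  have hb : b ≠ 0 := by
    rintro rfl
    rw [Nat.zero_mul] at hba
    rcases Nat.mul_eq_zero.1 hba.symm with h | h <;> omega
  have hND := hND hb
  by_cases h : 2 * b = k + 2
  · have hab' : a = b := by omega
    subst hab'
    have := Nat.eq_of_mul_eq_mul_left (by omega) hba
    omega
  -- The chain `k ≤ d < N ≤ 2b < k + 2` fixes every value. Then `bN = ad` forces `b = 1`, giving
  -- five vertices and contradicting `hn`.
  · have hk : k = 2 * b - 1 := by omega
    have hN : N = 2 * b := by omega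
    have hd : d = 2 * b - 1 := by omega
    have ha : a = b + 1 := by omega
    subst hN hd ha
    obtain ⟨c, rfl⟩ := Nat.exists_eq_succ_of_ne_zero hb
    have : 2 * (c + 1) - 1 = 2 * c + 1 := by omega
    simp only [Nat.succ_eq_add_one, this] at hba
    have hc : c = 0 := by nlinarith
    omega

/-- If `M₁(G)` reaches the bound, every inequality in its derivation from an independent set is
an equality. -/
lemma firstZagreb_extremal {I : Finset V} (hI : G.IsIndepSet (I : Set V)) (hδ : 0 < G.minDegree)
    (hIpos : 0 < I.card) (hJpos : 0 < Iᶜ.card)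
    (hM : (Iᶜ.card : ℝ) * (G.maxDegree : ℝ) ^ 2 +
        ((G.edgeFinset.card : ℝ) * ((G.minDegree : ℝ) + (Iᶜ.card : ℝ))) ^ 2 /
          (4 * (G.minDegree : ℝ) * (Iᶜ.card : ℝ) * (I.card : ℝ)) ≤ (firstZagreb G : ℝ)) :
    ∑ u ∈ I, G.degree u = G.edgeFinset.card ∧
      (∀ u ∈ I, G.degree u = G.minDegree ∨ G.degree u = Iᶜ.card) ∧
      (∀ v ∈ Iᶜ, G.degree v = G.maxDegree) ∧
      G.edgeFinset.card * (G.minDegree + Iᶜ.card) = 2 * I.card * G.minDegree * Iᶜ.card := by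
  set N := Iᶜ.card
  set c := I.card
  set d := G.minDegree
  set D := G.maxDegree
  set e := G.edgeFinset.card
  have hδ' : (0 : ℝ) < d := by exact_mod_cast hδ
  have hN' : (0 : ℝ) < N := by exact_mod_cast hJpos
  have hc' : (0 : ℝ) < c := by exact_mod_cast hIpos
  have hPterm : ∀ u ∈ I, (0 : ℝ) ≤ ((G.degree u : ℝ) - d) * (N - G.degree u) := by
    intro u hu
    have h1 : (d : ℝ) ≤ G.degree u := by exact_mod_cast G.minDegree_le_degree u
    have h2 : (G.degree u : ℝ) ≤ N := by
      exact_mod_cast (G.card_neighborFinset_eq_degree u).symm.le.trans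
        (Finset.card_le_card (neighborFinset_subset_compl hI hu))
    exact mul_nonneg (by linarith) (by linarith)
  have hQterm : ∀ v ∈ Iᶜ, (0 : ℝ) ≤ (D : ℝ) ^ 2 - (G.degree v : ℝ) ^ 2 := by
    intro v _
    have h1 : (G.degree v : ℝ) ≤ D := by exact_mod_cast G.degree_le_maxDegree v
    have h2 : (0 : ℝ) ≤ G.degree v := by positivity
    nlinarith
  set P := ∑ u ∈ I, ((G.degree u : ℝ) - d) * (N - G.degree u) with hP
  set Q := ∑ v ∈ Iᶜ, ((D : ℝ) ^ 2 - (G.degree v : ℝ) ^ 2) with hQ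
  have hP0 : 0 ≤ P := Finset.sum_nonneg hPterm
  have hQ0 : 0 ≤ Q := Finset.sum_nonneg hQterm
  have hR : ∑ u ∈ I, (G.degree u : ℝ) ≤ e := by
    exact_mod_cast (sum_degree_le_card_edgeFinset hI).1
  have hPeq : P = (d + N) * ∑ u ∈ I, (G.degree u : ℝ) - c * (d * N) -
      ∑ u ∈ I, (G.degree u : ℝ) ^ 2 := by
    rw [Finset.mul_sum, ← nsmul_eq_mul, ← Finset.sum_const, ← Finset.sum_sub_distrib,
      ← Finset.sum_sub_distrib]
    exact Finset.sum_congr rfl fun u _ => by ring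
  have hQeq : Q = N * (D : ℝ) ^ 2 - ∑ v ∈ Iᶜ, (G.degree v : ℝ) ^ 2 := by
    rw [hQ, Finset.sum_sub_distrib, Finset.sum_const, nsmul_eq_mul]
  have hMeq : (firstZagreb G : ℝ) =
      ∑ u ∈ I, (G.degree u : ℝ) ^ 2 + ∑ v ∈ Iᶜ, (G.degree v : ℝ) ^ 2 := by
    rw [Finset.sum_add_sum_compl, firstZagreb]
    push_cast
    rfl
  set X : ℝ := e * (d + N) with hX
  have hY : (0 : ℝ) < c * (d * N) := by positivity
  -- `X²/(4Y) = X - Y + (X - 2Y)²/(4Y)` with `Y = c d N`: the AM-GM slack made explicit.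
  have hsq : X ^ 2 / (4 * d * N * c) =
      X - c * (d * N) + (X - 2 * (c * (d * N))) ^ 2 /
      (4 * d * N * c) := by
    field_simp
    ring
  have hZ : 0 ≤ (X - 2 * (c * (d * N))) ^ 2 / (4 * d * N * c) := by positivity
  rw [hMeq, hsq] at hM
  have hdN : (0 : ℝ) < d + N := by positivity
  have hR' : 0 ≤ (d + N) * ((e : ℝ) - ∑ u ∈ I, (G.degree u : ℝ)) :=
    mul_nonneg hdN.le (by linarith)
  -- Four nonnegative slacks with nonpositive sum, so each vanishes.
  have htot : (d + N) * ((e : ℝ) - ∑ u ∈ I, (G.degree u : ℝ)) + P + Q +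
      (X - 2 * (c * (d * N))) ^ 2 / (4 * d * N * c) ≤ 0 := by
    rw [hPeq, hQeq]
    linarith
  have hRz : (d + N) * ((e : ℝ) - ∑ u ∈ I, (G.degree u : ℝ)) = 0 := by linarith
  have hPz : P = 0 := by linarith
  have hQz : Q = 0 := by linarith
  have hZz : (X - 2 * (c * (d * N))) ^ 2 / (4 * d * N * c) = 0 := by linarith
  refine ⟨?_, fun u hu => ?_, fun v hv => ?_, ?_⟩
  · have := (mul_eq_zero.1 hRz).resolve_left hdN.ne'
    have : ∑ u ∈ I, (G.degree u : ℝ) = e := by linarith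
    exact_mod_cast this
  · have := (Finset.sum_eq_zero_iff_of_nonneg hPterm).1 hPz u hu
    rcases mul_eq_zero.1 this with h | h
    · left
      exact_mod_cast sub_eq_zero.1 h
    · right
      exact_mod_cast (sub_eq_zero.1 h).symm
  · have := sub_eq_zero.1 ((Finset.sum_eq_zero_iff_of_nonneg hQterm).1 hQz v hv)
    have h : D ^ 2 = G.degree v ^ 2 := by exact_mod_cast this
    exact (Nat.pow_left_injective (n := 2) (by norm_num) h).symm
  · have h1 : (X - 2 * (c * (d * N))) ^ 2 = 0 :=
      (div_eq_zero_iff.1 hZz).resolve_right (by positivity)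
    have h2 : X - 2 * (c * (d * N)) = 0 := by simpa using h1
    have h3 : (e : ℝ) * (d + N) = 2 * c * d * N := by rw [← hX]; linarith
    exact_mod_cast h3

end ZagrebTraceable

/-! ### Assembly of the main theorem. -/

theorem theorem2 {V : Type*} [Fintype V] [DecidableEq V] (G : SimpleGraph V)
    [DecidableRel G.Adj] (k : ℕ) (hk : 1 ≤ k) (hn : 9 ≤ Fintype.card V)
    (hG : ZagrebTraceable.IsKConnected G k)
    (hM : (ZagrebTraceable.firstZagreb G : ℝ) ≥
      ((Fintype.card V : ℝ) - k - 2) * (G.maxDegree : ℝ) ^ 2 +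
        ((G.edgeFinset.card : ℝ) * ((G.minDegree : ℝ) + (Fintype.card V : ℝ) - k - 2)) ^ 2 /
          (4 * (G.minDegree : ℝ) * ((Fintype.card V : ℝ) - k - 2) * ((k : ℝ) + 2))) :
    ZagrebTraceable.IsTraceable G ∨
      Nonempty (G ≃g completeBipartiteGraph (Fin k) (Fin (k + 2))) := by
  open ZagrebTraceable in
  by_contra! hcon
  obtain ⟨hT, hiso⟩ := hcon
  obtain ⟨I, hI, hIc⟩ := exists_isIndepSet_of_not_isTraceable hk hG hT
  have hVne : Nonempty V := Fintype.card_pos_iff.1 (by omega)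
  have hcard := Finset.card_add_card_compl I
  have hdeg : k ≤ G.minDegree := G.le_minDegree_of_forall_le_degree k hG.le_degree
  have hIdeg : ∀ u ∈ I, G.degree u ≤ Iᶜ.card := fun u hu =>
    (G.card_neighborFinset_eq_degree u).symm.le.trans
      (Finset.card_le_card (neighborFinset_subset_compl hI hu))
  obtain ⟨u₀, hu₀⟩ : I.Nonempty := Finset.card_pos.1 (by omega)
  -- Rules out the degenerate case `k = n - 2`: a vertex of `I` has at least `k ≥ 1` neighbours, all
  -- in `Iᶜ`.
  have hJpos : 0 < Iᶜ.card := by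
    have h1 := hIdeg u₀ hu₀
    have h2 := hG.le_degree u₀
    omega
  have hcast : (Fintype.card V : ℝ) = Iᶜ.card + k + 2 := by
    rw [← hcard, hIc]
    push_cast
    ring
  have h1 : (Fintype.card V : ℝ) - k - 2 = Iᶜ.card := by rw [hcast]; ring
  have h2 : (G.minDegree : ℝ) + (Fintype.card V : ℝ) - k - 2 = G.minDegree + Iᶜ.card := by
    rw [hcast]; ring
  have h3 : (k : ℝ) + 2 = (I.card : ℝ) := by rw [hIc]; push_cast; rfl
  rw [h1, h2, h3] at hM
  obtain ⟨hsum, hIor, hJdeg, heq⟩ := firstZagreb_extremal hI (by omega) (by omega) hJpos hM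
  have hJ := (sum_degree_le_card_edgeFinset hI).2 hsum
  obtain ⟨v₀, hv₀⟩ : Iᶜ.Nonempty := Finset.card_pos.1 hJpos
  have hD : G.maxDegree ≤ k + 2 := by
    rw [← hJdeg v₀ hv₀, ← hIc, ← G.card_neighborFinset_eq_degree]
    simpa using Finset.card_le_card (neighborFinset_subset_compl hJ hv₀)
  rcases (show G.minDegree ≤ Iᶜ.card from (G.minDegree_le_degree u₀).trans (hIdeg u₀ hu₀)).lt_or_eq
    with hlt | hdN
  · have hJsum : ∑ v ∈ Iᶜ, G.degree v = Iᶜ.card * G.maxDegree := by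
      rw [Finset.sum_congr rfl hJdeg, Finset.sum_const, smul_eq_mul]
    have htot := Finset.sum_add_sum_compl I fun v => G.degree v
    rw [G.sum_degrees_eq_twice_card_edges] at htot
    have hfil := Finset.card_filter_add_card_filter_not (s := I)
      (fun u => G.degree u = G.minDegree)
    have hIsum : ∑ u ∈ I, G.degree u =
        (I.filter fun u => G.degree u = G.minDegree).card * G.minDegree +
          (I.filter fun u => ¬ G.degree u = G.minDegree).card * Iᶜ.card := by
      rw [← Finset.sum_filter_add_sum_filter_not I (fun u => G.degree u = G.minDegree)]
      congr 1
      · rw [← smul_eq_mul, ← Finset.sum_const]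
        exact Finset.sum_congr rfl fun u hu => (Finset.mem_filter.1 hu).2
      · rw [← smul_eq_mul, ← Finset.sum_const]
        exact Finset.sum_congr rfl fun u hu =>
          (hIor u (Finset.mem_filter.1 hu).1).resolve_left (Finset.mem_filter.1 hu).2
    refine bipartite_arithmetic hk (by omega) (hfil.trans hIc) hdeg hlt (fun hb => ?_) hD
      (by omega) (by rw [← hIsum, hsum, heq, hIc])
    obtain ⟨u, hu⟩ := Finset.card_pos.1 (Nat.pos_of_ne_zero hb)
    rw [Finset.mem_filter] at hu
    rw [← (hIor u hu.1).resolve_left hu.2]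
    exact G.degree_le_maxDegree u
  · have hadj : ∀ u ∈ I, ∀ v ∉ I, G.Adj u v := by
      intro u hu v hv
      have hdu : Iᶜ.card ≤ (G.neighborFinset u).card := by
        rw [G.card_neighborFinset_eq_degree, ← hdN]
        exact G.minDegree_le_degree u
      have := Finset.eq_of_subset_of_card_le (neighborFinset_subset_compl hI hu) hdu
      rw [← SimpleGraph.mem_neighborFinset, this]
      exact Finset.mem_compl.2 hv
    have hle : Iᶜ.card ≤ k + 2 := by
      rw [← hdN]
      exact (G.minDegree_le_maxDegree).trans hD
    rcases (show k ≤ Iᶜ.card by omega).eq_or_lt with h | h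
    · exact not_isEmpty_iff.2 (nonempty_iso_completeBipartiteGraph hadj hI hJ hIc h.symm) hiso
    · exact hT (isTraceable_of_complete_bipartite hadj hIc h hle)
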